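/- Let $R_0,R_k,R_\mu,R_\nu,R_\gamma>0$ and $\alpha>0$ be real numbers, and let $U\in C^2([0,1];\mathbb R)$, $W\in C^1([0,1];\mathbb R)$. Write $D=\frac{d}{dy}$. Consider the Orr–Sommerfeld problem for the micropolar shear flow $(U,W)$: for $y\in[0,1]$, $$i\alpha\big[(U-C)(D^2-\alpha^2)-U''\big]\varphi=\Big(\frac1{R_\mu}+\frac1{2R_k}\Big)(D^2-\alpha^2)^2\varphi+\frac{R_0}{R_k}(D^2-\alpha^2)\omega,$$ $$i\alpha\big[(U-C)\omega-W'\varphi\big]=\Big[\frac1{R_\gamma}(D^2-\alpha^2)-\frac{2R_0}{R_\nu}\Big]\omega-\frac1{R_\nu}(D^2-\alpha^2)\varphi,$$ with boundary conditions $$\varphi(0)=\varphi(1)=\varphi'(0)=\varphi'(1)=\omega(0)=\omega(1)=0 .$$ A complex number $C=C_r+iC_i$ is called an eigenvalue if this problem has a solution $(\varphi,\omega)\neq(0,0)$ with $\varphi\in C^4([0,1];\mathbb C)$ and $\omega\in C^2([0,1];\mathbb C)$. Put $$q_1=\max_{y\in[0,1]}|U'(y)|,\qquad q_2=\max_{y\in[0,1]}|W'(y)|,$$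 $$R_1=\min\Big\{\frac1{R_\mu},\frac1{2R_k},\frac{R_0}{R_\nu}\Big\},\qquad R_2=\max\Big\{\frac{R_0}{2R_k},\frac1{2R_\nu}\Big\},$$ and assume $R_1>R_2$. Let $R>0$ be defined by $$\frac1R=\min\Big\{R_1-R_2,\ \frac1{R_\mu}+\frac1{2R_k},\ \frac1{R_\gamma}\Big\}.$$ Then every eigenvalue $C$ satisfies $$C_i\le\frac{q_1+q_2}{2\alpha}-\frac{\pi^2+\alpha^2}{\alpha R}.$$ Moreover, there is no eigenvalue with $C_i>0$ (no amplified disturbance) if $$\alpha Rq_1<\max\{M_1,M_2\}\quad\text{and}\quad \alpha Rq_2<\max\{N_1,N_2\},$$ where $$M_1=(4.73)^2\pi+2\alpha^2\pi,\qquad M_2=(4.73)^2\pi+2^{3/2}\alpha^3,$$ $$N_1=2(4.73)^2\pi+2\alpha^3,\qquad N_2=2(4.73)^2\pi+2^{3/2}\alpha\pi .$$ -/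

import Mathlib

open Set

namespace Micropolar

/-- The operator `D = d/dy` on functions on `[0,1]`, with one-sided derivatives at the
two end points. -/
noncomputable def D {E : Type*} [NormedAddCommGroup E] [NormedSpace ℝ E]
    (f : ℝ → E) : ℝ → E :=
  derivWithin f (Icc 0 1)

/-- The operator `D² - α²` on complex-valued functions on `[0,1]`. -/
noncomputable def DSq (α : ℝ) (f : ℝ → ℂ) : ℝ → ℂ :=
  fun y => D (D f) y - (α : ℂ) ^ 2 * f y

/-- `(φ, ω)` is a classical solution on `[0,1]`, for the wave number `α` and the mode `C`, of the
Orr-Sommerfeld equations for the micropolar base flow `(U, W)`, with clamped boundary conditions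
for `φ` and Dirichlet conditions for `ω`. -/
structure IsSolution (R₀ Rk Rμ Rν Rγ α : ℝ) (U W : ℝ → ℝ) (C : ℂ) (φ ω : ℝ → ℂ) : Prop where
  contDiffOn_φ : ContDiffOn ℝ 4 φ (Icc 0 1)
  contDiffOn_ω : ContDiffOn ℝ 2 ω (Icc 0 1)
  eq_φ : ∀ y ∈ Icc (0 : ℝ) 1,
    Complex.I * (α : ℂ) * (((U y : ℂ) - C) * DSq α φ y - ((D (D U) y : ℝ) : ℂ) * φ y) =
      (1 / (Rμ : ℂ) + 1 / (2 * (Rk : ℂ))) * DSq α (DSq α φ) y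
        + ((R₀ : ℂ) / (Rk : ℂ)) * DSq α ω y
  eq_ω : ∀ y ∈ Icc (0 : ℝ) 1,
    Complex.I * (α : ℂ) * (((U y : ℂ) - C) * ω y - ((D W y : ℝ) : ℂ) * φ y) =
      (1 / (Rγ : ℂ)) * DSq α ω y - (2 * (R₀ : ℂ) / (Rν : ℂ)) * ω y
        - (1 / (Rν : ℂ)) * DSq α φ y
  φ_zero : φ 0 = 0
  φ_one : φ 1 = 0
  deriv_φ_zero : D φ 0 = 0
  deriv_φ_one : D φ 1 = 0
  ω_zero : ω 0 = 0
  ω_one : ω 1 = 0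

/-- `C` is an eigenvalue: there is a solution `(φ, ω)` that is not identically zero on `[0,1]`. -/
def IsEigenvalue (R₀ Rk Rμ Rν Rγ α : ℝ) (U W : ℝ → ℝ) (C : ℂ) : Prop :=
  ∃ φ ω : ℝ → ℂ, IsSolution R₀ Rk Rμ Rν Rγ α U W C φ ω ∧
    ∃ y ∈ Icc (0 : ℝ) 1, φ y ≠ 0 ∨ ω y ≠ 0

end Micropolar

namespace Micropolar

open MeasureTheory

/-! The proof is an energy method. Pair the first equation with the conjugate of φ and the second
with the conjugate of ω, take real parts and integrate. With E = ∫|φ'|² + α²∫|φ|² + ∫|ω|², this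
bounds αC_i E by production minus dissipation. Production is αq₁∫|φ||φ'| + αq₂∫|φ||ω|, and
dissipation is 1/R times 2∫|(D²-α²)φ|² + 2∫|ω|² + ∫|ω'|² + α²∫|ω|². The two coupling terms cost at
most 2R₂(∫|(D²-α²)φ|² + ∫|ω|²), hence the factor R₁ - R₂ (`IsSolution.energy`).

Three sharp inequalities then compare the integrals: Poincaré with π² for φ and for ω, and Wirtinger
with (2π)² for φ', which is periodic with mean zero because φ is clamped. Together with weighted
Young inequalities they give production at most (q₁+q₂)E/2 and dissipation at least (π²+α²)E/R
(`growth_rate_le`). Below the thresholds, they show that production does not exceed dissipation,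
which excludes C_i > 0 (`production_le_dissipation`). -/

/-- Fundamental theorem of calculus on `[0,1]` with one-sided derivatives at the end points. -/
lemma integral_eq_sub_of_hasDerivWithinAt {E : Type*} [NormedAddCommGroup E] [NormedSpace ℝ E]
    [CompleteSpace E] {F F' : ℝ → E}
    (hF : ∀ x ∈ Icc (0 : ℝ) 1, HasDerivWithinAt F (F' x) (Icc 0 1) x)
    (hF' : ContinuousOn F' (Icc 0 1)) : ∫ x in (0 : ℝ)..1, F' x = F 1 - F 0 :=
  intervalIntegral.integral_eq_sub_of_hasDerivAt_of_le zero_le_one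
    (fun x hx => (hF x hx).continuousWithinAt)
    (fun x hx => (hF x (Ioo_subset_Icc_self hx)).hasDerivAt (Icc_mem_nhds hx.1 hx.2))
    (hF'.intervalIntegrable_of_Icc zero_le_one)

lemma hasDerivWithinAt_norm_sq {f : ℝ → ℂ} {f' : ℂ} {s : Set ℝ} {x : ℝ}
    (hf : HasDerivWithinAt f f' s x) :
    HasDerivWithinAt (fun y => ‖f y‖ ^ 2) (2 * (star (f x) * f').re) s x := by
  have := hf.norm_sq
  convert this using 2
  simp [Complex.inner, mul_comm]

lemma norm_sq_add_real_mul (a b : ℂ) (t : ℝ) :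
    ‖a + t * b‖ ^ 2 = ‖a‖ ^ 2 + 2 * t * (star b * a).re + t ^ 2 * ‖b‖ ^ 2 := by
  simp only [← Complex.normSq_eq_norm_sq, Complex.normSq_apply]
  simp
  ring

/-! ### Sharp Poincaré and Wirtinger inequalities -/

section Poincare

variable {f f' : ℝ → ℂ}

/-- Poincaré inequality for Dirichlet data, below the optimal constant. -/
lemma sq_mul_integral_le_of_lt_pi
    (hf : ∀ x ∈ Icc (0 : ℝ) 1, HasDerivWithinAt f (f' x) (Icc 0 1) x)
    (hf' : ContinuousOn f' (Icc 0 1)) (h0 : f 0 = 0) (h1 : f 1 = 0)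
    {k : ℝ} (hk : 0 < k) (hkπ : k < Real.pi) :
    k ^ 2 * ∫ x in (0 : ℝ)..1, ‖f x‖ ^ 2 ≤ ∫ x in (0 : ℝ)..1, ‖f' x‖ ^ 2 := by
  have hfc : ContinuousOn f (Icc 0 1) := fun x hx => (hf x hx).continuousWithinAt
  -- Since k < π, the argument stays inside (-π/2, π/2), so the tangent below is smooth up to both
  -- end points.
  have hcos : ∀ x ∈ Icc (0 : ℝ) 1, 0 < Real.cos (k * (x - 1 / 2)) := fun x hx =>
    Real.cos_pos_of_mem_Ioo ⟨by nlinarith [hx.1, hx.2], by nlinarith [hx.1, hx.2]⟩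
  have htan : ∀ x ∈ Icc (0 : ℝ) 1, HasDerivWithinAt (fun y => Real.tan (k * (y - 1 / 2)))
      (k * (1 + Real.tan (k * (x - 1 / 2)) ^ 2)) (Icc 0 1) x := fun x hx => by
    have h := (Real.hasDerivAt_tan (hcos x hx).ne').comp x
      (((hasDerivAt_id x).sub_const (1 / 2)).const_mul k)
    refine h.hasDerivWithinAt.congr_deriv ?_
    have hc := (hcos x hx).ne'
    rw [Real.tan_eq_sin_div_cos]
    generalize k * (x - 1 / 2) = θ at hc ⊢
    field_simp
    exact (Real.cos_sq_add_sin_sq θ).symm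
  set T : ℝ → ℝ := fun y => Real.tan (k * (y - 1 / 2)) with hT
  have hTc : ContinuousOn T (Icc 0 1) := fun x hx => (htan x hx).continuousWithinAt
  have key : ∫ x in (0 : ℝ)..1, (k * (1 + T x ^ 2) * ‖f x‖ ^ 2 + T x * (2 * (star (f x) * f' x).re))
      = T 1 * ‖f 1‖ ^ 2 - T 0 * ‖f 0‖ ^ 2 :=
    integral_eq_sub_of_hasDerivWithinAt (F := fun x => T x * ‖f x‖ ^ 2)
      (fun x hx => (htan x hx).mul (hasDerivWithinAt_norm_sq (hf x hx))) (by fun_prop)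
  -- Complete the square around cos(k(x - 1/2)), which solves f' = -kTf. As T' = k(1 + T²), the
  -- remainder is k times the derivative of T|f|², whose integral vanishes.
  have key2 : ∫ x in (0 : ℝ)..1, ‖f' x + ((k * T x : ℝ) : ℂ) * f x‖ ^ 2 =
      ∫ x in (0 : ℝ)..1, (‖f' x‖ ^ 2 - k ^ 2 * ‖f x‖ ^ 2 + k *
        (k * (1 + T x ^ 2) * ‖f x‖ ^ 2 + T x * (2 * (star (f x) * f' x).re))) := by
    congr 1 with x
    rw [norm_sq_add_real_mul]
    ring
  have hpos : 0 ≤ ∫ x in (0 : ℝ)..1, ‖f' x + ((k * T x : ℝ) : ℂ) * f x‖ ^ 2 :=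
    intervalIntegral.integral_nonneg zero_le_one fun x _ => by positivity
  rw [key2, intervalIntegral.integral_add, intervalIntegral.integral_sub,
    intervalIntegral.integral_const_mul, intervalIntegral.integral_const_mul, key, h0, h1] at hpos
  · simpa using hpos
  all_goals exact ContinuousOn.intervalIntegrable_of_Icc zero_le_one (by fun_prop)

/-- Poincaré inequality for Dirichlet data on `[0,1]` with the optimal constant. -/
lemma pi_sq_mul_integral_le
    (hf : ∀ x ∈ Icc (0 : ℝ) 1, HasDerivWithinAt f (f' x) (Icc 0 1) x)
    (hf' : ContinuousOn f' (Icc 0 1)) (h0 : f 0 = 0) (h1 : f 1 = 0) :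
    Real.pi ^ 2 * ∫ x in (0 : ℝ)..1, ‖f x‖ ^ 2 ≤ ∫ x in (0 : ℝ)..1, ‖f' x‖ ^ 2 := by
  -- At k = π the tangent blows up at both ends, so the optimal constant is reached as a limit from
  -- below.
  have hlim : Filter.Tendsto (fun k : ℝ => k ^ 2 * ∫ x in (0 : ℝ)..1, ‖f x‖ ^ 2)
      (nhdsWithin Real.pi (Iio Real.pi))
      (nhds (Real.pi ^ 2 * ∫ x in (0 : ℝ)..1, ‖f x‖ ^ 2)) :=
    (Continuous.tendsto (by fun_prop) _).mono_left nhdsWithin_le_nhds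
  refine le_of_tendsto hlim ?_
  filter_upwards [Ioo_mem_nhdsLT Real.pi_pos] with k hk
  exact sq_mul_integral_le_of_lt_pi hf hf' h0 h1 hk.1 hk.2

/-- Wirtinger's inequality for periodic functions of mean zero on `[0,1]`. -/
lemma two_pi_sq_mul_integral_le
    (hf : ∀ x ∈ Icc (0 : ℝ) 1, HasDerivWithinAt f (f' x) (Icc 0 1) x)
    (hf' : ContinuousOn f' (Icc 0 1)) (hper : f 1 = f 0)
    (hmean : ∫ x in (0 : ℝ)..1, f x = 0) :
    (2 * Real.pi) ^ 2 * ∫ x in (0 : ℝ)..1, ‖f x‖ ^ 2 ≤ ∫ x in (0 : ℝ)..1, ‖f' x‖ ^ 2 := by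
  have hfc : ContinuousOn f (Icc 0 1) := fun x hx => (hf x hx).continuousWithinAt
  have hL2 : ∀ g : ℝ → ℂ, ContinuousOn g (Icc 0 1) →
      MemLp g 2 (volume.restrict (Ioc (0 : ℝ) 1)) := fun g hg => by
    obtain ⟨M, hM⟩ := isCompact_Icc.exists_bound_of_continuousOn hg
    exact MemLp.of_bound
      ((hg.mono Ioc_subset_Icc_self).aestronglyMeasurable measurableSet_Ioc) M
      (ae_restrict_of_forall_mem measurableSet_Ioc fun x hx => hM x (Ioc_subset_Icc_self hx))
  have H := (hasSum_sq_fourierCoeffOn zero_lt_one (hL2 f hfc)).mul_left ((2 * Real.pi) ^ 2)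
  have H' := hasSum_sq_fourierCoeffOn zero_lt_one (hL2 f' hf')
  simp only [sub_zero, inv_one, one_smul] at H H'
  -- Parseval on both sides, compared mode by mode: mode 0 of f vanishes by the mean condition, and
  -- for n ≠ 0 periodicity makes coefficient n of f equal to that of f' divided by 2πin.
  refine hasSum_le (fun n => ?_) H H'
  rcases eq_or_ne n 0 with rfl | hn
  · have : fourierCoeffOn zero_lt_one f 0 = 0 := by
      rw [fourierCoeffOn_eq_integral]
      simp [hmean]
    rw [this]
    simp
  · rw [fourierCoeffOn_of_hasDerivAt_Ioo zero_lt_one hn (by simpa using hfc)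
      (fun x hx => by
        simp only [zero_le_one, min_eq_left, max_eq_right] at hx
        exact (hf x (Ioo_subset_Icc_self hx)).hasDerivAt (Icc_mem_nhds hx.1 hx.2))
      (hf'.intervalIntegrable_of_Icc zero_le_one), hper]
    have hn1 : (1 : ℝ) ≤ (n : ℝ) ^ 2 := by
      exact_mod_cast (show (1 : ℤ) ≤ n ^ 2 by have := sq_pos_of_ne_zero hn; lia)
    have hn0 : (0 : ℝ) < |(n : ℝ)| := by positivity
    simp only [sub_self, mul_zero, zero_sub, Complex.ofReal_one, Complex.ofReal_zero, sub_zero,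
      one_mul, norm_mul, norm_neg, norm_div, norm_one, Complex.norm_I, Complex.norm_real,
      Complex.norm_ofNat, Complex.norm_intCast, Real.norm_eq_abs, abs_of_pos Real.pi_pos, mul_one]
    have h : (2 * Real.pi) ^ 2 * (1 / (2 * Real.pi * |(n : ℝ)|) *
        ‖fourierCoeffOn zero_lt_one f' n‖) ^ 2 =
        ‖fourierCoeffOn zero_lt_one f' n‖ ^ 2 / (n : ℝ) ^ 2 := by
      rw [← sq_abs (n : ℝ)]
      field_simp
    rw [h]
    exact div_le_self (sq_nonneg _) hn1

end Poincare

section Derivatives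

variable {E : Type*} [NormedAddCommGroup E] [NormedSpace ℝ E] {f : ℝ → E}

lemma hasDerivWithinAt_D (hf : ContDiffOn ℝ 1 f (Icc 0 1)) :
    ∀ x ∈ Icc (0 : ℝ) 1, HasDerivWithinAt f (D f x) (Icc 0 1) x := fun x hx =>
  (hf.differentiableOn one_ne_zero x hx).hasDerivWithinAt

lemma contDiffOn_D {m n : WithTop ℕ∞} (hf : ContDiffOn ℝ n f (Icc 0 1)) (hmn : m + 1 ≤ n) :
    ContDiffOn ℝ m (D f) (Icc 0 1) :=
  hf.derivWithin (uniqueDiffOn_Icc zero_lt_one) hmn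

end Derivatives

/-! ### Integration by parts for D² - α² -/

section IntegrationByParts

variable {f g : ℝ → ℂ}

/-- Symmetry of `D² - α²` when one of the functions satisfies clamped boundary conditions. -/
lemma integral_re_star_mul_DSq_of_clamped (α : ℝ) (hf : ContDiffOn ℝ 2 f (Icc 0 1))
    (hg : ContDiffOn ℝ 2 g (Icc 0 1)) (h0 : f 0 = 0) (h1 : f 1 = 0) (h0' : D f 0 = 0)
    (h1' : D f 1 = 0) :
    ∫ x in (0 : ℝ)..1, (star (f x) * DSq α g x).re =
      ∫ x in (0 : ℝ)..1, (star (DSq α f x) * g x).re := by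
  have hf1 : ContDiffOn ℝ 1 (D f) (Icc 0 1) := contDiffOn_D hf (by norm_num)
  have hg1 : ContDiffOn ℝ 1 (D g) (Icc 0 1) := contDiffOn_D hg (by norm_num)
  have hf2 : ContDiffOn ℝ 0 (D (D f)) (Icc 0 1) := contDiffOn_D hf1 (by norm_num)
  have hg2 : ContDiffOn ℝ 0 (D (D g)) (Icc 0 1) := contDiffOn_D hg1 (by norm_num)
  have cf := hf.continuousOn
  have cg := hg.continuousOn
  have cf1 := hf1.continuousOn
  have cg1 := hg1.continuousOn
  have cf2 := hf2.continuousOn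
  have cg2 := hg2.continuousOn
  have df := hasDerivWithinAt_D (hf.of_le one_le_two)
  have dg := hasDerivWithinAt_D (hg.of_le one_le_two)
  have df1 := hasDerivWithinAt_D hf1
  have dg1 := hasDerivWithinAt_D hg1
  -- The boundary term involves only values of f and Df at the ends, so g needs no boundary
  -- conditions; this matters for g = (D²-α²)φ.
  have key := integral_eq_sub_of_hasDerivWithinAt
    (F := fun x => (star (f x) * D g x - star (D f x) * g x).re)
    (F' := fun x => (star (D f x) * D g x + star (f x) * D (D g) x
      - (star (D (D f) x) * g x + star (D f x) * D g x)).re)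
    (fun x hx => Complex.reCLM.hasFDerivAt.comp_hasDerivWithinAt x
      (((df x hx).star.mul (dg1 x hx)).sub ((df1 x hx).star.mul (dg x hx))))
    (by
      refine Complex.continuous_re.comp_continuousOn ?_
      fun_prop)
  rw [h0, h1, h0', h1'] at key
  rw [← sub_eq_zero, ← intervalIntegral.integral_sub]
  · refine (intervalIntegral.integral_congr fun x _ => ?_).trans (key.trans (by simp))
    simp [DSq, ← Complex.ofReal_pow]
    ring
  all_goals
    refine ContinuousOn.intervalIntegrable_of_Icc zero_le_one
      (Complex.continuous_re.comp_continuousOn ?_)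
    unfold DSq
    fun_prop

/-- Integration by parts for a function with Dirichlet data. -/
lemma integral_re_star_mul_D_D (hf : ContDiffOn ℝ 2 f (Icc 0 1)) (h0 : f 0 = 0) (h1 : f 1 = 0) :
    ∫ x in (0 : ℝ)..1, (star (f x) * D (D f) x).re = - ∫ x in (0 : ℝ)..1, ‖D f x‖ ^ 2 := by
  have hf1 : ContDiffOn ℝ 1 (D f) (Icc 0 1) := contDiffOn_D hf (by norm_num)
  have hf2 : ContDiffOn ℝ 0 (D (D f)) (Icc 0 1) := contDiffOn_D hf1 (by norm_num)
  have cf := hf.continuousOn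
  have cf1 := hf1.continuousOn
  have cf2 := hf2.continuousOn
  have df := hasDerivWithinAt_D (hf.of_le one_le_two)
  have df1 := hasDerivWithinAt_D hf1
  have key := integral_eq_sub_of_hasDerivWithinAt
    (F := fun x => (star (f x) * D f x).re)
    (F' := fun x => (star (D f x) * D f x + star (f x) * D (D f) x).re)
    (fun x hx => Complex.reCLM.hasFDerivAt.comp_hasDerivWithinAt x
      ((df x hx).star.mul (df1 x hx)))
    (Complex.continuous_re.comp_continuousOn (by fun_prop))
  rw [h0, h1] at key
  rw [← sub_eq_zero, sub_neg_eq_add, ← intervalIntegral.integral_add]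
  · refine (intervalIntegral.integral_congr fun x _ => ?_).trans (key.trans (by simp))
    simp [← Complex.normSq_eq_norm_sq, Complex.normSq_apply]
    ring
  · exact ContinuousOn.intervalIntegrable_of_Icc zero_le_one
      (Complex.continuous_re.comp_continuousOn (by fun_prop))
  · exact ContinuousOn.intervalIntegrable_of_Icc zero_le_one (by fun_prop)

/-- Weighted integration by parts for the imaginary part. -/
lemma integral_mul_im_star_mul_D_D {u : ℝ → ℝ} (hu : ContDiffOn ℝ 1 u (Icc 0 1))
    (hf : ContDiffOn ℝ 2 f (Icc 0 1)) (h0 : f 0 = 0) (h1 : f 1 = 0) :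
    ∫ x in (0 : ℝ)..1, u x * (star (f x) * D (D f) x).im =
      - ∫ x in (0 : ℝ)..1, D u x * (star (f x) * D f x).im := by
  have hf1 : ContDiffOn ℝ 1 (D f) (Icc 0 1) := contDiffOn_D hf (by norm_num)
  have hf2 : ContDiffOn ℝ 0 (D (D f)) (Icc 0 1) := contDiffOn_D hf1 (by norm_num)
  have hu1 : ContDiffOn ℝ 0 (D u) (Icc 0 1) := contDiffOn_D hu (by norm_num)
  have cf := hf.continuousOn
  have cf1 := hf1.continuousOn
  have cf2 := hf2.continuousOn
  have cu := hu.continuousOn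
  have cu1 := hu1.continuousOn
  have df := hasDerivWithinAt_D (hf.of_le one_le_two)
  have df1 := hasDerivWithinAt_D hf1
  have c1 : ContinuousOn (fun x => (star (f x) * D f x).im) (Icc 0 1) :=
    Complex.continuous_im.comp_continuousOn (by fun_prop)
  have c2 : ContinuousOn (fun x => (star (f x) * D (D f) x).im) (Icc 0 1) :=
    Complex.continuous_im.comp_continuousOn (by fun_prop)
  have c3 : ContinuousOn (fun x => (star (D f x) * D f x + star (f x) * D (D f) x).im)
      (Icc 0 1) :=
    Complex.continuous_im.comp_continuousOn (by fun_prop)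
  have key := integral_eq_sub_of_hasDerivWithinAt
    (F := fun x => u x * (star (f x) * D f x).im)
    (F' := fun x => D u x * (star (f x) * D f x).im +
      u x * (star (D f x) * D f x + star (f x) * D (D f) x).im)
    (fun x hx => (hasDerivWithinAt_D hu x hx).mul
      (Complex.imCLM.hasFDerivAt.comp_hasDerivWithinAt x ((df x hx).star.mul (df1 x hx))))
    ((cu1.mul c1).add (cu.mul c3))
  rw [h0, h1] at key
  rw [← sub_eq_zero, sub_neg_eq_add, ← intervalIntegral.integral_add]
  · refine (intervalIntegral.integral_congr fun x _ => ?_).trans (key.trans (by simp))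
    simp
    ring
  · exact ContinuousOn.intervalIntegrable_of_Icc zero_le_one (cu.mul c2)
  · exact ContinuousOn.intervalIntegrable_of_Icc zero_le_one (cu1.mul c1)

lemma integral_im_star_mul_D_D (hf : ContDiffOn ℝ 2 f (Icc 0 1)) (h0 : f 0 = 0) (h1 : f 1 = 0) :
    ∫ x in (0 : ℝ)..1, (star (f x) * D (D f) x).im = 0 := by
  have h := integral_mul_im_star_mul_D_D (u := fun _ => 1) contDiffOn_const hf h0 h1
  simpa [D] using h

lemma re_star_mul_DSq (α : ℝ) (f : ℝ → ℂ) (x : ℝ) :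
    (star (f x) * DSq α f x).re = (star (f x) * D (D f) x).re - α ^ 2 * ‖f x‖ ^ 2 := by
  simp [DSq, ← Complex.ofReal_pow, ← Complex.normSq_eq_norm_sq, Complex.normSq_apply]
  ring

lemma im_star_mul_DSq (α : ℝ) (f : ℝ → ℂ) (x : ℝ) :
    (star (f x) * DSq α f x).im = (star (f x) * D (D f) x).im := by
  simp [DSq, ← Complex.ofReal_pow]
  ring

lemma integral_re_star_mul_DSq (α : ℝ) (hf : ContDiffOn ℝ 2 f (Icc 0 1)) (h0 : f 0 = 0)
    (h1 : f 1 = 0) :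
    ∫ x in (0 : ℝ)..1, (star (f x) * DSq α f x).re =
      - ((∫ x in (0 : ℝ)..1, ‖D f x‖ ^ 2) + α ^ 2 * ∫ x in (0 : ℝ)..1, ‖f x‖ ^ 2) := by
  have hf1 : ContDiffOn ℝ 1 (D f) (Icc 0 1) := contDiffOn_D hf (by norm_num)
  have hf2 : ContDiffOn ℝ 0 (D (D f)) (Icc 0 1) := contDiffOn_D hf1 (by norm_num)
  have cf := hf.continuousOn
  have cf2 := hf2.continuousOn
  simp_rw [re_star_mul_DSq]
  rw [intervalIntegral.integral_sub, intervalIntegral.integral_const_mul,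
    integral_re_star_mul_D_D hf h0 h1]
  · ring
  · exact ContinuousOn.intervalIntegrable_of_Icc zero_le_one
      (Complex.continuous_re.comp_continuousOn (by fun_prop))
  · exact ContinuousOn.intervalIntegrable_of_Icc zero_le_one (by fun_prop)

lemma integral_norm_sq_DSq (α : ℝ) (hf : ContDiffOn ℝ 2 f (Icc 0 1)) (h0 : f 0 = 0)
    (h1 : f 1 = 0) :
    ∫ x in (0 : ℝ)..1, ‖DSq α f x‖ ^ 2 =
      (∫ x in (0 : ℝ)..1, ‖D (D f) x‖ ^ 2) + 2 * α ^ 2 * (∫ x in (0 : ℝ)..1, ‖D f x‖ ^ 2)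
        + α ^ 4 * ∫ x in (0 : ℝ)..1, ‖f x‖ ^ 2 := by
  have hf1 : ContDiffOn ℝ 1 (D f) (Icc 0 1) := contDiffOn_D hf (by norm_num)
  have hf2 : ContDiffOn ℝ 0 (D (D f)) (Icc 0 1) := contDiffOn_D hf1 (by norm_num)
  have cf := hf.continuousOn
  have cf2 := hf2.continuousOn
  have c : ContinuousOn (fun x => (star (f x) * D (D f) x).re) (Icc 0 1) :=
    Complex.continuous_re.comp_continuousOn (by fun_prop)
  have h : ∀ x, ‖DSq α f x‖ ^ 2 = ‖D (D f) x‖ ^ 2 - 2 * α ^ 2 * (star (f x) * D (D f) x).re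
      + α ^ 4 * ‖f x‖ ^ 2 := fun x => by
    have := norm_sq_add_real_mul (D (D f) x) (f x) (-α ^ 2)
    rw [DSq, sub_eq_add_neg]
    push_cast at this
    rw [← neg_mul, this]
    ring
  simp_rw [h]
  rw [intervalIntegral.integral_add, intervalIntegral.integral_sub,
    intervalIntegral.integral_const_mul, intervalIntegral.integral_const_mul,
    integral_re_star_mul_D_D hf h0 h1]
  · ring
  all_goals exact ContinuousOn.intervalIntegrable_of_Icc zero_le_one (by fun_prop)

end IntegrationByParts

lemma contDiffOn_DSq {α : ℝ} {f : ℝ → ℂ} {m n : WithTop ℕ∞} (hf : ContDiffOn ℝ n f (Icc 0 1))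
    (hmn : m + 1 + 1 ≤ n) : ContDiffOn ℝ m (DSq α f) (Icc 0 1) :=
  (contDiffOn_D (contDiffOn_D hf hmn) le_rfl).sub
    (contDiffOn_const.mul (hf.of_le ((le_self_add.trans le_self_add).trans hmn)))

lemma continuousOn_star_mul_re {f g : ℝ → ℂ} {s : Set ℝ} (hf : ContinuousOn f s)
    (hg : ContinuousOn g s) : ContinuousOn (fun x => (star (f x) * g x).re) s :=
  Complex.continuous_re.comp_continuousOn (hf.star.mul hg)

lemma continuousOn_star_mul_im {f g : ℝ → ℂ} {s : Set ℝ} (hf : ContinuousOn f s)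
    (hg : ContinuousOn g s) : ContinuousOn (fun x => (star (f x) * g x).im) s :=
  Complex.continuous_im.comp_continuousOn (hf.star.mul hg)

/-! ### Energy inequalities for the two equations -/

section Energy

variable {R₀ Rk Rμ Rν Rγ α : ℝ} {U W : ℝ → ℝ} {C : ℂ} {φ ω : ℝ → ℂ}

/-- U and U'' are real, so their products with |φ|² become purely imaginary after the factor iα and
drop out. Re C survives only against a term whose integral is zero. -/
lemma IsSolution.re_eq_φ (h : IsSolution R₀ Rk Rμ Rν Rγ α U W C φ ω) {y : ℝ}
    (hy : y ∈ Icc (0 : ℝ) 1) :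
    α * C.im * (star (φ y) * DSq α φ y).re =
      (1 / Rμ + 1 / (2 * Rk)) * (star (φ y) * DSq α (DSq α φ) y).re
        + R₀ / Rk * (star (φ y) * DSq α ω y).re
        + α * (U y * (star (φ y) * D (D φ) y).im) - α * C.re * (star (φ y) * D (D φ) y).im := by
  have h1 := congrArg (fun z => (star (φ y) * z).re) (h.eq_φ y hy)
  have e1 : (1 / (Rμ : ℂ) + 1 / (2 * (Rk : ℂ))) = ((1 / Rμ + 1 / (2 * Rk) : ℝ) : ℂ) := by
    push_cast; rfl
  have e2 : (R₀ : ℂ) / (Rk : ℂ) = ((R₀ / Rk : ℝ) : ℂ) := by push_cast; rfl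
  rw [← im_star_mul_DSq α φ y]
  rw [e1, e2] at h1
  simp only [Complex.mul_re, Complex.mul_im, Complex.add_re, Complex.add_im, Complex.sub_re,
    Complex.sub_im, Complex.ofReal_re, Complex.ofReal_im, Complex.I_re, Complex.I_im,
    Complex.star_def, Complex.conj_re, Complex.conj_im] at h1 ⊢
  linear_combination h1

lemma IsSolution.re_eq_ω (h : IsSolution R₀ Rk Rμ Rν Rγ α U W C φ ω) {y : ℝ}
    (hy : y ∈ Icc (0 : ℝ) 1) :
    α * C.im * ‖ω y‖ ^ 2 =
      1 / Rγ * (star (ω y) * DSq α ω y).re - 2 * R₀ / Rν * ‖ω y‖ ^ 2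
        - 1 / Rν * (star (ω y) * DSq α φ y).re - α * (D W y * (star (ω y) * φ y).im) := by
  have h1 := congrArg (fun z => (star (ω y) * z).re) (h.eq_ω y hy)
  have e1 : 1 / (Rγ : ℂ) = ((1 / Rγ : ℝ) : ℂ) := by push_cast; rfl
  have e2 : 2 * (R₀ : ℂ) / (Rν : ℂ) = ((2 * R₀ / Rν : ℝ) : ℂ) := by push_cast; rfl
  have e3 : 1 / (Rν : ℂ) = ((1 / Rν : ℝ) : ℂ) := by push_cast; rfl
  rw [e1, e2, e3] at h1
  rw [← Complex.normSq_eq_norm_sq, Complex.normSq_apply]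
  simp only [Complex.mul_re, Complex.mul_im, Complex.sub_re,
    Complex.sub_im, Complex.ofReal_re, Complex.ofReal_im, Complex.I_re, Complex.I_im,
    Complex.star_def, Complex.conj_re, Complex.conj_im] at h1 ⊢
  linear_combination h1

lemma mul_im_star_mul_le {a q : ℝ} (hq : |a| ≤ q) (z w : ℂ) :
    -(a * (star z * w).im) ≤ q * (‖z‖ * ‖w‖) :=
  calc -(a * (star z * w).im) ≤ |a| * |(star z * w).im| := by
        rw [← abs_mul]
        exact neg_le_abs _
    _ ≤ q * (‖z‖ * ‖w‖) := by
        refine mul_le_mul hq ((Complex.abs_im_le_norm _).trans ?_) (abs_nonneg _)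
          ((abs_nonneg _).trans hq)
        simp

lemma neg_re_star_mul_le (z w : ℂ) : -(star z * w).re ≤ ‖z‖ * ‖w‖ :=
  (neg_le_abs _).trans ((Complex.abs_re_le_norm _).trans (by simp))

/-- Energy inequality for the stream function. -/
lemma IsSolution.energy_φ (h : IsSolution R₀ Rk Rμ Rν Rγ α U W C φ ω) (hα : 0 < α)
    (hR : 0 ≤ R₀ / Rk) (hU : ContDiffOn ℝ 1 U (Icc 0 1)) {q : ℝ}
    (hq : ∀ y ∈ Icc (0 : ℝ) 1, |D U y| ≤ q) :
    α * C.im * ((∫ x in (0 : ℝ)..1, ‖D φ x‖ ^ 2) + α ^ 2 * ∫ x in (0 : ℝ)..1, ‖φ x‖ ^ 2) ≤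
      α * q * (∫ x in (0 : ℝ)..1, ‖φ x‖ * ‖D φ x‖)
        - (1 / Rμ + 1 / (2 * Rk)) * (∫ x in (0 : ℝ)..1, ‖DSq α φ x‖ ^ 2)
        + R₀ / Rk * ∫ x in (0 : ℝ)..1, ‖DSq α φ x‖ * ‖ω x‖ := by
  have hφ2 : ContDiffOn ℝ 2 φ (Icc 0 1) := h.contDiffOn_φ.of_le (by norm_num)
  have hA : ContDiffOn ℝ 2 (DSq α φ) (Icc 0 1) := contDiffOn_DSq h.contDiffOn_φ (by norm_num)
  have hDφ : ContDiffOn ℝ 1 (D φ) (Icc 0 1) := contDiffOn_D hφ2 (by norm_num)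
  have hDDφ : ContDiffOn ℝ 0 (D (D φ)) (Icc 0 1) := contDiffOn_D hDφ (by norm_num)
  have hDU : ContDiffOn ℝ 0 (D U) (Icc 0 1) := contDiffOn_D hU (by norm_num)
  have hAA : ContDiffOn ℝ 0 (DSq α (DSq α φ)) (Icc 0 1) := contDiffOn_DSq hA (by norm_num)
  have hAω : ContDiffOn ℝ 0 (DSq α ω) (Icc 0 1) := contDiffOn_DSq h.contDiffOn_ω (by norm_num)
  have cφ := hφ2.continuousOn
  have cDφ := hDφ.continuousOn
  have cA := hA.continuousOn
  have cω := h.contDiffOn_ω.continuousOn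
  have cDU := hDU.continuousOn
  have cU := hU.continuousOn
  have c1 := continuousOn_star_mul_re cφ hAA.continuousOn
  have c2 := continuousOn_star_mul_re cφ hAω.continuousOn
  have c3 := continuousOn_star_mul_im cφ hDDφ.continuousOn
  have c4 := continuousOn_star_mul_im cφ cDφ
  have c5 := continuousOn_star_mul_re cA cω
  have key : α * C.im * ∫ y in (0 : ℝ)..1, (star (φ y) * DSq α φ y).re =
      ∫ y in (0 : ℝ)..1, ((1 / Rμ + 1 / (2 * Rk)) * (star (φ y) * DSq α (DSq α φ) y).re
        + R₀ / Rk * (star (φ y) * DSq α ω y).re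
        + α * (U y * (star (φ y) * D (D φ) y).im)
        - α * C.re * (star (φ y) * D (D φ) y).im) := by
    rw [← intervalIntegral.integral_const_mul]
    exact intervalIntegral.integral_congr fun y hy =>
      h.re_eq_φ (by simpa using hy)
  rw [intervalIntegral.integral_sub, intervalIntegral.integral_add, intervalIntegral.integral_add,
    intervalIntegral.integral_const_mul, intervalIntegral.integral_const_mul,
    intervalIntegral.integral_const_mul, intervalIntegral.integral_const_mul,
    integral_im_star_mul_D_D hφ2 h.φ_zero h.φ_one,
    integral_mul_im_star_mul_D_D hU hφ2 h.φ_zero h.φ_one,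
    integral_re_star_mul_DSq α hφ2 h.φ_zero h.φ_one,
    integral_re_star_mul_DSq_of_clamped α hφ2 hA h.φ_zero h.φ_one h.deriv_φ_zero h.deriv_φ_one,
    integral_re_star_mul_DSq_of_clamped α hφ2 h.contDiffOn_ω h.φ_zero h.φ_one h.deriv_φ_zero
      h.deriv_φ_one] at key
  · have hQ : ∫ x in (0 : ℝ)..1, (star (DSq α φ x) * DSq α φ x).re =
        ∫ x in (0 : ℝ)..1, ‖DSq α φ x‖ ^ 2 := by
      congr 1 with x
      simp [← Complex.normSq_eq_norm_sq, Complex.normSq_apply]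
    have h1 : ∫ x in (0 : ℝ)..1, D U x * (star (φ x) * D φ x).im ≤
        q * ∫ x in (0 : ℝ)..1, ‖φ x‖ * ‖D φ x‖ := by
      rw [← intervalIntegral.integral_const_mul]
      refine intervalIntegral.integral_mono_on zero_le_one ?_ ?_ fun x hx => ?_
      · exact ContinuousOn.intervalIntegrable_of_Icc zero_le_one (by fun_prop)
      · exact ContinuousOn.intervalIntegrable_of_Icc zero_le_one (by fun_prop)
      · simpa using mul_im_star_mul_le (a := -D U x) (by simpa using hq x hx) (φ x) (D φ x)
    have h2 : -∫ x in (0 : ℝ)..1, (star (DSq α φ x) * ω x).re ≤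
        ∫ x in (0 : ℝ)..1, ‖DSq α φ x‖ * ‖ω x‖ := by
      rw [← intervalIntegral.integral_neg]
      refine intervalIntegral.integral_mono_on zero_le_one ?_ ?_ fun x _ => ?_
      · exact ContinuousOn.intervalIntegrable_of_Icc zero_le_one c5.neg
      · exact ContinuousOn.intervalIntegrable_of_Icc zero_le_one (by fun_prop)
      · exact neg_re_star_mul_le _ _
    rw [hQ] at key
    linarith [mul_le_mul_of_nonneg_left h1 hα.le, mul_le_mul_of_nonneg_left h2 hR]
  all_goals exact ContinuousOn.intervalIntegrable_of_Icc zero_le_one (by fun_prop)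

/-- Energy inequality for the microrotation. -/
lemma IsSolution.energy_ω (h : IsSolution R₀ Rk Rμ Rν Rγ α U W C φ ω) (hα : 0 < α)
    (hR : 0 ≤ 1 / Rν) (hW : ContDiffOn ℝ 1 W (Icc 0 1)) {q : ℝ}
    (hq : ∀ y ∈ Icc (0 : ℝ) 1, |D W y| ≤ q) :
    α * C.im * (∫ x in (0 : ℝ)..1, ‖ω x‖ ^ 2) ≤
      α * q * (∫ x in (0 : ℝ)..1, ‖φ x‖ * ‖ω x‖)
        - 1 / Rγ * ((∫ x in (0 : ℝ)..1, ‖D ω x‖ ^ 2) + α ^ 2 * ∫ x in (0 : ℝ)..1, ‖ω x‖ ^ 2)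
        - 2 * R₀ / Rν * (∫ x in (0 : ℝ)..1, ‖ω x‖ ^ 2)
        + 1 / Rν * ∫ x in (0 : ℝ)..1, ‖DSq α φ x‖ * ‖ω x‖ := by
  have hA : ContDiffOn ℝ 2 (DSq α φ) (Icc 0 1) := contDiffOn_DSq h.contDiffOn_φ (by norm_num)
  have hDW : ContDiffOn ℝ 0 (D W) (Icc 0 1) := contDiffOn_D hW (by norm_num)
  have hAω : ContDiffOn ℝ 0 (DSq α ω) (Icc 0 1) := contDiffOn_DSq h.contDiffOn_ω (by norm_num)
  have cφ := h.contDiffOn_φ.continuousOn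
  have cA := hA.continuousOn
  have cω := h.contDiffOn_ω.continuousOn
  have cDW := hDW.continuousOn
  have c1 := continuousOn_star_mul_re cω hAω.continuousOn
  have c2 := continuousOn_star_mul_re cω cA
  have c3 := continuousOn_star_mul_im cω cφ
  have key : α * C.im * ∫ y in (0 : ℝ)..1, ‖ω y‖ ^ 2 =
      ∫ y in (0 : ℝ)..1, (1 / Rγ * (star (ω y) * DSq α ω y).re - 2 * R₀ / Rν * ‖ω y‖ ^ 2
        - 1 / Rν * (star (ω y) * DSq α φ y).re - α * (D W y * (star (ω y) * φ y).im)) := by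
    rw [← intervalIntegral.integral_const_mul]
    exact intervalIntegral.integral_congr fun y hy =>
      h.re_eq_ω (by simpa using hy)
  rw [intervalIntegral.integral_sub, intervalIntegral.integral_sub, intervalIntegral.integral_sub,
    intervalIntegral.integral_const_mul, intervalIntegral.integral_const_mul,
    intervalIntegral.integral_const_mul, intervalIntegral.integral_const_mul,
    integral_re_star_mul_DSq α h.contDiffOn_ω h.ω_zero h.ω_one] at key
  · have h1 : -∫ x in (0 : ℝ)..1, D W x * (star (ω x) * φ x).im ≤
        q * ∫ x in (0 : ℝ)..1, ‖φ x‖ * ‖ω x‖ := by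
      rw [← intervalIntegral.integral_const_mul, ← intervalIntegral.integral_neg]
      refine intervalIntegral.integral_mono_on zero_le_one ?_ ?_ fun x hx => ?_
      · exact ContinuousOn.intervalIntegrable_of_Icc zero_le_one (by fun_prop)
      · exact ContinuousOn.intervalIntegrable_of_Icc zero_le_one (by fun_prop)
      · rw [mul_comm ‖φ x‖]
        exact mul_im_star_mul_le (hq x hx) (ω x) (φ x)
    have h2 : -∫ x in (0 : ℝ)..1, (star (ω x) * DSq α φ x).re ≤
        ∫ x in (0 : ℝ)..1, ‖DSq α φ x‖ * ‖ω x‖ := by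
      rw [← intervalIntegral.integral_neg]
      refine intervalIntegral.integral_mono_on zero_le_one ?_ ?_ fun x _ => ?_
      · exact ContinuousOn.intervalIntegrable_of_Icc zero_le_one c2.neg
      · exact ContinuousOn.intervalIntegrable_of_Icc zero_le_one (by fun_prop)
      · rw [mul_comm ‖DSq α φ x‖]
        exact neg_re_star_mul_le _ _
    linarith [mul_le_mul_of_nonneg_left h1 hα.le, mul_le_mul_of_nonneg_left h2 hR]
  all_goals exact ContinuousOn.intervalIntegrable_of_Icc zero_le_one (by fun_prop)

end Energy

/-- Young's inequality for integrals over `[0,1]`. -/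
lemma mul_integral_norm_mul_norm_le {f g : ℝ → ℂ} (hf : ContinuousOn f (Icc 0 1))
    (hg : ContinuousOn g (Icc 0 1)) (a b : ℝ) :
    2 * a * b * (∫ x in (0 : ℝ)..1, ‖f x‖ * ‖g x‖) ≤
      a ^ 2 * (∫ x in (0 : ℝ)..1, ‖f x‖ ^ 2) + b ^ 2 * ∫ x in (0 : ℝ)..1, ‖g x‖ ^ 2 := by
  rw [← intervalIntegral.integral_const_mul, ← intervalIntegral.integral_const_mul,
    ← intervalIntegral.integral_const_mul, ← intervalIntegral.integral_add]
  · refine intervalIntegral.integral_mono_on zero_le_one ?_ ?_ fun x _ => ?_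
    · exact ContinuousOn.intervalIntegrable_of_Icc zero_le_one (by fun_prop)
    · exact ContinuousOn.intervalIntegrable_of_Icc zero_le_one (by fun_prop)
    · nlinarith [sq_nonneg (a * ‖f x‖ - b * ‖g x‖)]
  all_goals exact ContinuousOn.intervalIntegrable_of_Icc zero_le_one (by fun_prop)

lemma integral_norm_sq_pos {f : ℝ → ℂ} (hf : ContinuousOn f (Icc 0 1)) {y : ℝ}
    (hy : y ∈ Icc (0 : ℝ) 1) (hfy : f y ≠ 0) : 0 < ∫ x in (0 : ℝ)..1, ‖f x‖ ^ 2 :=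
  intervalIntegral.integral_pos zero_lt_one (by fun_prop) (fun x _ => by positivity)
    ⟨y, hy, by positivity⟩

/-! ### Total energy balance and stability estimates -/

section Stability

variable {R₀ Rk Rμ Rν Rγ α : ℝ} {U W : ℝ → ℝ} {C : ℂ} {φ ω : ℝ → ℂ}

/-- The total energy inequality, with dissipation rate `r`. -/
lemma IsSolution.energy (h : IsSolution R₀ Rk Rμ Rν Rγ α U W C φ ω)
    (hR₀ : 0 < R₀) (hRk : 0 < Rk) (hRν : 0 < Rν) (hα : 0 < α)
    (hU : ContDiffOn ℝ 1 U (Icc 0 1)) (hW : ContDiffOn ℝ 1 W (Icc 0 1)) {q₁ q₂ : ℝ}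
    (hq₁ : ∀ y ∈ Icc (0 : ℝ) 1, |D U y| ≤ q₁) (hq₂ : ∀ y ∈ Icc (0 : ℝ) 1, |D W y| ≤ q₂)
    {R₁ R₂ r : ℝ} (hμ : R₁ ≤ 1 / Rμ) (hk : R₁ ≤ 1 / (2 * Rk)) (hν : R₁ ≤ R₀ / Rν)
    (hk' : R₀ / (2 * Rk) ≤ R₂) (hν' : 1 / (2 * Rν) ≤ R₂) (hr : r ≤ R₁ - R₂)
    (hγ : r ≤ 1 / Rγ) :
    α * C.im * ((∫ x in (0 : ℝ)..1, ‖D φ x‖ ^ 2) + α ^ 2 * (∫ x in (0 : ℝ)..1, ‖φ x‖ ^ 2)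
        + ∫ x in (0 : ℝ)..1, ‖ω x‖ ^ 2) ≤
      α * q₁ * (∫ x in (0 : ℝ)..1, ‖φ x‖ * ‖D φ x‖)
        + α * q₂ * (∫ x in (0 : ℝ)..1, ‖φ x‖ * ‖ω x‖)
        - r * (2 * (∫ x in (0 : ℝ)..1, ‖DSq α φ x‖ ^ 2) + 2 * (∫ x in (0 : ℝ)..1, ‖ω x‖ ^ 2)
          + (∫ x in (0 : ℝ)..1, ‖D ω x‖ ^ 2) + α ^ 2 * ∫ x in (0 : ℝ)..1, ‖ω x‖ ^ 2) := by
  have hA : ContDiffOn ℝ 2 (DSq α φ) (Icc 0 1) := contDiffOn_DSq h.contDiffOn_φ (by norm_num)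
  have h1 := h.energy_φ hα (by positivity) hU hq₁
  have h2 := h.energy_ω hα (by positivity) hW hq₂
  have hK := mul_integral_norm_mul_norm_le hA.continuousOn h.contDiffOn_ω.continuousOn 1 1
  have hK0 : 0 ≤ ∫ x in (0 : ℝ)..1, ‖DSq α φ x‖ * ‖ω x‖ :=
    intervalIntegral.integral_nonneg zero_le_one fun x _ => by positivity
  have hQ0 : 0 ≤ ∫ x in (0 : ℝ)..1, ‖DSq α φ x‖ ^ 2 :=
    intervalIntegral.integral_nonneg zero_le_one fun x _ => by positivity
  have hJ0 : 0 ≤ ∫ x in (0 : ℝ)..1, ‖ω x‖ ^ 2 :=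
    intervalIntegral.integral_nonneg zero_le_one fun x _ => by positivity
  have hJ1 : 0 ≤ ∫ x in (0 : ℝ)..1, ‖D ω x‖ ^ 2 :=
    intervalIntegral.integral_nonneg zero_le_one fun x _ => by positivity
  generalize (∫ x in (0 : ℝ)..1, ‖DSq α φ x‖ * ‖ω x‖) = K at *
  generalize (∫ x in (0 : ℝ)..1, ‖DSq α φ x‖ ^ 2) = Q at *
  generalize (∫ x in (0 : ℝ)..1, ‖ω x‖ ^ 2) = J at *
  generalize (∫ x in (0 : ℝ)..1, ‖D ω x‖ ^ 2) = J' at *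
  have hR₂ : 0 ≤ R₂ := le_trans (by positivity) hν'
  have e1 : R₀ / Rk = 2 * (R₀ / (2 * Rk)) := by field_simp
  have e2 : 1 / Rν = 2 * (1 / (2 * Rν)) := by field_simp
  have e3 : 2 * R₀ / Rν = 2 * (R₀ / Rν) := by ring
  -- The coupling costs 4R₂K ≤ 2R₂(Q + J), while viscosity and rotational damping supply at least
  -- 2R₁(Q + J).
  have m1 : (R₀ / Rk + 1 / Rν) * K ≤ 4 * R₂ * K :=
    mul_le_mul_of_nonneg_right (by linarith) hK0
  have m2 : 2 * R₂ * (2 * K) ≤ 2 * R₂ * (Q + J) :=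
    mul_le_mul_of_nonneg_left (by linarith) (by positivity)
  have m3 : 2 * R₁ * Q ≤ (1 / Rμ + 1 / (2 * Rk)) * Q :=
    mul_le_mul_of_nonneg_right (by linarith) hQ0
  have m4 : 2 * R₁ * J ≤ 2 * R₀ / Rν * J := mul_le_mul_of_nonneg_right (by linarith) hJ0
  have m5 : r * (J' + α ^ 2 * J) ≤ 1 / Rγ * (J' + α ^ 2 * J) :=
    mul_le_mul_of_nonneg_right hγ (by positivity)
  have m6 : r * (2 * (Q + J)) ≤ (R₁ - R₂) * (2 * (Q + J)) :=
    mul_le_mul_of_nonneg_right hr (by positivity)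
  linarith

lemma IsSolution.norm_sq_integral_pos (h : IsSolution R₀ Rk Rμ Rν Rγ α U W C φ ω) (hα : 0 < α)
    (hne : ∃ y ∈ Icc (0 : ℝ) 1, φ y ≠ 0 ∨ ω y ≠ 0) :
    0 < (∫ x in (0 : ℝ)..1, ‖D φ x‖ ^ 2) + α ^ 2 * (∫ x in (0 : ℝ)..1, ‖φ x‖ ^ 2)
        + ∫ x in (0 : ℝ)..1, ‖ω x‖ ^ 2 := by
  have n1 : 0 ≤ ∫ x in (0 : ℝ)..1, ‖D φ x‖ ^ 2 :=
    intervalIntegral.integral_nonneg zero_le_one fun x _ => by positivity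
  have n2 : 0 ≤ ∫ x in (0 : ℝ)..1, ‖φ x‖ ^ 2 :=
    intervalIntegral.integral_nonneg zero_le_one fun x _ => by positivity
  have n3 : 0 ≤ ∫ x in (0 : ℝ)..1, ‖ω x‖ ^ 2 :=
    intervalIntegral.integral_nonneg zero_le_one fun x _ => by positivity
  obtain ⟨y, hy, h' | h'⟩ := hne
  · have := integral_norm_sq_pos h.contDiffOn_φ.continuousOn hy h'
    positivity
  · have := integral_norm_sq_pos h.contDiffOn_ω.continuousOn hy h'
    positivity

lemma IsSolution.pi_sq_mul_integral_φ_le (h : IsSolution R₀ Rk Rμ Rν Rγ α U W C φ ω) :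
    Real.pi ^ 2 * ∫ x in (0 : ℝ)..1, ‖φ x‖ ^ 2 ≤ ∫ x in (0 : ℝ)..1, ‖D φ x‖ ^ 2 :=
  pi_sq_mul_integral_le (hasDerivWithinAt_D (h.contDiffOn_φ.of_le (by norm_num)))
    (contDiffOn_D (m := 0) h.contDiffOn_φ (by norm_num)).continuousOn h.φ_zero h.φ_one

lemma IsSolution.pi_sq_mul_integral_ω_le (h : IsSolution R₀ Rk Rμ Rν Rγ α U W C φ ω) :
    Real.pi ^ 2 * ∫ x in (0 : ℝ)..1, ‖ω x‖ ^ 2 ≤ ∫ x in (0 : ℝ)..1, ‖D ω x‖ ^ 2 :=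
  pi_sq_mul_integral_le (hasDerivWithinAt_D (h.contDiffOn_ω.of_le (by norm_num)))
    (contDiffOn_D (m := 0) h.contDiffOn_ω (by norm_num)).continuousOn h.ω_zero h.ω_one

/-- The clamped conditions make Dφ vanish at both ends, and its mean is φ(1) - φ(0) = 0. -/
lemma IsSolution.two_pi_sq_mul_integral_le (h : IsSolution R₀ Rk Rμ Rν Rγ α U W C φ ω) :
    (2 * Real.pi) ^ 2 * ∫ x in (0 : ℝ)..1, ‖D φ x‖ ^ 2 ≤
      ∫ x in (0 : ℝ)..1, ‖D (D φ) x‖ ^ 2 := by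
  have hD : ContDiffOn ℝ 1 (D φ) (Icc 0 1) := contDiffOn_D h.contDiffOn_φ (by norm_num)
  refine Micropolar.two_pi_sq_mul_integral_le (hasDerivWithinAt_D hD)
    (contDiffOn_D (m := 0) hD (by norm_num)).continuousOn
    (by rw [h.deriv_φ_zero, h.deriv_φ_one]) ?_
  rw [integral_eq_sub_of_hasDerivWithinAt
    (hasDerivWithinAt_D (h.contDiffOn_φ.of_le (by norm_num))) hD.continuousOn, h.φ_zero, h.φ_one,
    sub_zero]

/-- Numerical consequence of the Wirtinger inequalities; it replaces the optimal constant of the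
clamped beam. -/
lemma clamped_bound {a b c : ℝ} (ha : 0 ≤ a) (hab : Real.pi ^ 2 * a ≤ b)
    (hbc : (2 * Real.pi) ^ 2 * b ≤ c) :
    (4.73 : ℝ) ^ 2 * b + (4.73 : ℝ) ^ 4 * a ≤ 2 * c := by
  -- Only the sum is controlled: b ≥ 9.85a bounds the left side by about 73.2b, and 2c ≥ 78.8b.
  -- Chaining the two hypotheses would give only c ≥ 4π⁴a, short of 4.73⁴a.
  have hπ : (9.85 : ℝ) ≤ Real.pi ^ 2 := by nlinarith [Real.pi_gt_d2]
  have hb : 9.85 * a ≤ b := (mul_le_mul_of_nonneg_right hπ ha).trans hab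
  have hb0 : 0 ≤ b := by linarith
  nlinarith [mul_le_mul_of_nonneg_right hπ hb0]

lemma IsSolution.growth_rate_le (h : IsSolution R₀ Rk Rμ Rν Rγ α U W C φ ω) (hα : 0 < α)
    (hne : ∃ y ∈ Icc (0 : ℝ) 1, φ y ≠ 0 ∨ ω y ≠ 0) {q₁ q₂ r : ℝ} (hq₁ : 0 ≤ q₁) (hq₂ : 0 ≤ q₂)
    (hr : 0 ≤ r)
    (hE : α * C.im * ((∫ x in (0 : ℝ)..1, ‖D φ x‖ ^ 2)
        + α ^ 2 * (∫ x in (0 : ℝ)..1, ‖φ x‖ ^ 2) + ∫ x in (0 : ℝ)..1, ‖ω x‖ ^ 2) ≤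
      α * q₁ * (∫ x in (0 : ℝ)..1, ‖φ x‖ * ‖D φ x‖)
        + α * q₂ * (∫ x in (0 : ℝ)..1, ‖φ x‖ * ‖ω x‖)
        - r * (2 * (∫ x in (0 : ℝ)..1, ‖DSq α φ x‖ ^ 2) + 2 * (∫ x in (0 : ℝ)..1, ‖ω x‖ ^ 2)
          + (∫ x in (0 : ℝ)..1, ‖D ω x‖ ^ 2) + α ^ 2 * ∫ x in (0 : ℝ)..1, ‖ω x‖ ^ 2)) :
    α * C.im ≤ (q₁ + q₂) / 2 - (Real.pi ^ 2 + α ^ 2) * r := by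
  have hφ2 : ContDiffOn ℝ 2 φ (Icc 0 1) := h.contDiffOn_φ.of_le (by norm_num)
  have cφ := hφ2.continuousOn
  have cDφ : ContinuousOn (D φ) (Icc 0 1) :=
    (contDiffOn_D (m := 0) hφ2 (by norm_num)).continuousOn
  have hX := mul_integral_norm_mul_norm_le cφ cDφ α 1
  have hY := mul_integral_norm_mul_norm_le cφ h.contDiffOn_ω.continuousOn α 1
  have hpos := h.norm_sq_integral_pos hα hne
  have p1 := h.pi_sq_mul_integral_φ_le
  have p2 := h.two_pi_sq_mul_integral_le
  have p3 := h.pi_sq_mul_integral_ω_le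
  have n1 : 0 ≤ ∫ x in (0 : ℝ)..1, ‖D φ x‖ ^ 2 :=
    intervalIntegral.integral_nonneg zero_le_one fun x _ => by positivity
  have n2 : 0 ≤ ∫ x in (0 : ℝ)..1, ‖φ x‖ ^ 2 :=
    intervalIntegral.integral_nonneg zero_le_one fun x _ => by positivity
  have n3 : 0 ≤ ∫ x in (0 : ℝ)..1, ‖ω x‖ ^ 2 :=
    intervalIntegral.integral_nonneg zero_le_one fun x _ => by positivity
  rw [integral_norm_sq_DSq α hφ2 h.φ_zero h.φ_one] at hE
  generalize (∫ x in (0 : ℝ)..1, ‖φ x‖ * ‖D φ x‖) = X at *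
  generalize (∫ x in (0 : ℝ)..1, ‖φ x‖ * ‖ω x‖) = Y at *
  generalize (∫ x in (0 : ℝ)..1, ‖φ x‖ ^ 2) = a at *
  generalize (∫ x in (0 : ℝ)..1, ‖D φ x‖ ^ 2) = b at *
  generalize (∫ x in (0 : ℝ)..1, ‖D (D φ) x‖ ^ 2) = c at *
  generalize (∫ x in (0 : ℝ)..1, ‖ω x‖ ^ 2) = J at *
  generalize (∫ x in (0 : ℝ)..1, ‖D ω x‖ ^ 2) = J' at *
  refine le_of_mul_le_mul_right ?_ hpos
  have hα2 : 0 ≤ α ^ 2 * a := by positivity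
  have m1 : q₁ * (2 * α * X) ≤ q₁ * (b + α ^ 2 * a + J) :=
    mul_le_mul_of_nonneg_left (by linarith) hq₁
  have m2 : q₂ * (2 * α * Y) ≤ q₂ * (b + α ^ 2 * a + J) :=
    mul_le_mul_of_nonneg_left (by linarith) hq₂
  have hc0 : 0 ≤ c := le_trans (by positivity) p2
  have hcb : Real.pi ^ 2 * b ≤ c := by nlinarith [mul_nonneg (sq_nonneg Real.pi) n1]
  have hα4 : 0 ≤ α ^ 4 * a := by positivity
  have hα2b : 0 ≤ α ^ 2 * b := by positivity
  have hab : α ^ 2 * (Real.pi ^ 2 * a) ≤ α ^ 2 * b := mul_le_mul_of_nonneg_left p1 (sq_nonneg α)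
  -- Termwise: π²b ≤ c, π²α²a ≤ α²b and π²J ≤ J'; the α² multiples are already present.
  have m3 : r * ((Real.pi ^ 2 + α ^ 2) * (b + α ^ 2 * a + J)) ≤
      r * (2 * (c + 2 * α ^ 2 * b + α ^ 4 * a) + 2 * J + J' + α ^ 2 * J) :=
    mul_le_mul_of_nonneg_left (by nlinarith) hr
  linarith

lemma IsSolution.production_le_dissipation (h : IsSolution R₀ Rk Rμ Rν Rγ α U W C φ ω)
    (hα : 0 < α) {m n : ℝ}
    (hm : m ≤ max ((4.73 : ℝ) ^ 2 * Real.pi + 2 * α ^ 2 * Real.pi)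
          ((4.73 : ℝ) ^ 2 * Real.pi + (2 : ℝ) ^ (3 / 2 : ℝ) * α ^ 3))
    (hn : n ≤ max (2 * (4.73 : ℝ) ^ 2 * Real.pi + 2 * α ^ 3)
          (2 * (4.73 : ℝ) ^ 2 * Real.pi + (2 : ℝ) ^ (3 / 2 : ℝ) * α * Real.pi)) :
    m * (∫ x in (0 : ℝ)..1, ‖φ x‖ * ‖D φ x‖) + n * (∫ x in (0 : ℝ)..1, ‖φ x‖ * ‖ω x‖) ≤
      2 * (∫ x in (0 : ℝ)..1, ‖DSq α φ x‖ ^ 2) + 2 * (∫ x in (0 : ℝ)..1, ‖ω x‖ ^ 2)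
          + (∫ x in (0 : ℝ)..1, ‖D ω x‖ ^ 2) + α ^ 2 * ∫ x in (0 : ℝ)..1, ‖ω x‖ ^ 2 := by
  have hφ2 : ContDiffOn ℝ 2 φ (Icc 0 1) := h.contDiffOn_φ.of_le (by norm_num)
  have cφ := hφ2.continuousOn
  have cω := h.contDiffOn_ω.continuousOn
  have cDφ : ContinuousOn (D φ) (Icc 0 1) :=
    (contDiffOn_D (m := 0) hφ2 (by norm_num)).continuousOn
  have hs2 : √2 ^ 2 = (2 : ℝ) := Real.sq_sqrt (by norm_num)
  have hs : (2 : ℝ) ^ (3 / 2 : ℝ) = 2 * √2 := by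
    rw [show (3 / 2 : ℝ) = 1 + 1 / 2 by norm_num, Real.rpow_add (by norm_num), Real.rpow_one,
      Real.sqrt_eq_rpow]
  rw [hs] at hm hn
  -- Young weights are matched to the thresholds: `x1` and `x2` give the α-terms of M₁ and M₂ (`x1`
  -- also the 4.73²π term), `y1` the 4.73²π term of both N's, `y2` and `y3` the α-terms of N₁ and
  -- N₂.
  have x1 := mul_integral_norm_mul_norm_le cφ cDφ Real.pi 1
  have x2 := mul_integral_norm_mul_norm_le cφ cDφ (α ^ 2) (√2 * α)
  have y1 := mul_integral_norm_mul_norm_le cφ cω ((4.73 : ℝ) ^ 2) Real.pi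
  have y2 := mul_integral_norm_mul_norm_le cφ cω (α ^ 2) α
  have y3 := mul_integral_norm_mul_norm_le cφ cω (√2 * α * Real.pi) 1
  have p1 := h.pi_sq_mul_integral_φ_le
  have p2 := h.two_pi_sq_mul_integral_le
  have p3 := h.pi_sq_mul_integral_ω_le
  have n1 : 0 ≤ ∫ x in (0 : ℝ)..1, ‖D φ x‖ ^ 2 :=
    intervalIntegral.integral_nonneg zero_le_one fun x _ => by positivity
  have n2 : 0 ≤ ∫ x in (0 : ℝ)..1, ‖φ x‖ ^ 2 :=
    intervalIntegral.integral_nonneg zero_le_one fun x _ => by positivity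
  have n3 : 0 ≤ ∫ x in (0 : ℝ)..1, ‖ω x‖ ^ 2 :=
    intervalIntegral.integral_nonneg zero_le_one fun x _ => by positivity
  have nX : 0 ≤ ∫ x in (0 : ℝ)..1, ‖φ x‖ * ‖D φ x‖ :=
    intervalIntegral.integral_nonneg zero_le_one fun x _ => by positivity
  have nY : 0 ≤ ∫ x in (0 : ℝ)..1, ‖φ x‖ * ‖ω x‖ :=
    intervalIntegral.integral_nonneg zero_le_one fun x _ => by positivity
  rw [integral_norm_sq_DSq α hφ2 h.φ_zero h.φ_one]
  generalize (∫ x in (0 : ℝ)..1, ‖φ x‖ * ‖D φ x‖) = X at *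
  generalize (∫ x in (0 : ℝ)..1, ‖φ x‖ * ‖ω x‖) = Y at *
  generalize (∫ x in (0 : ℝ)..1, ‖φ x‖ ^ 2) = a at *
  generalize (∫ x in (0 : ℝ)..1, ‖D φ x‖ ^ 2) = b at *
  generalize (∫ x in (0 : ℝ)..1, ‖D (D φ) x‖ ^ 2) = c at *
  generalize (∫ x in (0 : ℝ)..1, ‖ω x‖ ^ 2) = J at *
  generalize (∫ x in (0 : ℝ)..1, ‖D ω x‖ ^ 2) = J' at *
  have hc := clamped_bound n2 p1 p2
  have hα4 : 0 ≤ α ^ 4 * a := by positivity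
  have hα2b : 0 ≤ α ^ 2 * b := by positivity
  have hα2J : 0 ≤ α ^ 2 * J := by positivity
  have hX : Real.pi * X ≤ b := by linarith
  have hab : α ^ 2 * (Real.pi ^ 2 * a) ≤ α ^ 2 * b := mul_le_mul_of_nonneg_left p1 (sq_nonneg α)
  have hαX : α ^ 2 * (Real.pi * X) ≤ α ^ 2 * b := mul_le_mul_of_nonneg_left hX (sq_nonneg α)
  rw [mul_pow, hs2] at x2
  rw [mul_pow, mul_pow, hs2] at y3
  have hmX : m * X ≤ 4.73 ^ 2 * b + 2 * α ^ 2 * b + α ^ 4 * a := by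
    refine (mul_le_mul_of_nonneg_right hm nX).trans ?_
    rw [max_mul_of_nonneg _ _ nX]
    exact max_le (by linarith) (by linarith)
  -- This bound and `hmX` add up to the dissipation exactly, once `clamped_bound` absorbs 4.73²b +
  -- 4.73⁴a into 2c.
  have hnY : n * Y ≤ 4.73 ^ 4 * a + J' + 2 * J + 2 * α ^ 2 * b + α ^ 4 * a + α ^ 2 * J := by
    refine (mul_le_mul_of_nonneg_right hn nY).trans ?_
    rw [max_mul_of_nonneg _ _ nY]
    exact max_le (by linarith) (by linarith)
  linarith

end Stability

end Micropolar

/-! ### The growth-rate bound and the stability criterion -/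

theorem theorem1
    (R₀ Rk Rμ Rν Rγ α : ℝ)
    (hR₀ : 0 < R₀) (hRk : 0 < Rk) (hRμ : 0 < Rμ) (hRν : 0 < Rν) (hRγ : 0 < Rγ) (hα : 0 < α)
    (U W : ℝ → ℝ)
    (hU : ContDiffOn ℝ 2 U (Icc 0 1)) (hW : ContDiffOn ℝ 1 W (Icc 0 1))
    (q₁ q₂ : ℝ)
    (hq₁ : IsGreatest ((fun y => |Micropolar.D U y|) '' Icc (0 : ℝ) 1) q₁)
    (hq₂ : IsGreatest ((fun y => |Micropolar.D W y|) '' Icc (0 : ℝ) 1) q₂)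
    (R₁ R₂ R : ℝ)
    (hR₁ : R₁ = min (1 / Rμ) (min (1 / (2 * Rk)) (R₀ / Rν)))
    (hR₂ : R₂ = max (R₀ / (2 * Rk)) (1 / (2 * Rν)))
    (hR : 1 / R = min (R₁ - R₂) (min (1 / Rμ + 1 / (2 * Rk)) (1 / Rγ)))
    (hlt : R₂ < R₁) :
    (∀ C : ℂ, Micropolar.IsEigenvalue R₀ Rk Rμ Rν Rγ α U W C →
      C.im ≤ (q₁ + q₂) / (2 * α) - (Real.pi ^ 2 + α ^ 2) / (α * R)) ∧
    (α * R * q₁ <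
        max ((4.73 : ℝ) ^ 2 * Real.pi + 2 * α ^ 2 * Real.pi)
          ((4.73 : ℝ) ^ 2 * Real.pi + (2 : ℝ) ^ (3 / 2 : ℝ) * α ^ 3) →
      α * R * q₂ <
        max (2 * (4.73 : ℝ) ^ 2 * Real.pi + 2 * α ^ 3)
          (2 * (4.73 : ℝ) ^ 2 * Real.pi + (2 : ℝ) ^ (3 / 2 : ℝ) * α * Real.pi) →
      ¬ ∃ C : ℂ, Micropolar.IsEigenvalue R₀ Rk Rμ Rν Rγ α U W C ∧ 0 < C.im) := by
  have hq₁' : ∀ y ∈ Icc (0 : ℝ) 1, |Micropolar.D U y| ≤ q₁ := fun y hy => hq₁.2 ⟨y, hy, rfl⟩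
  have hq₂' : ∀ y ∈ Icc (0 : ℝ) 1, |Micropolar.D W y| ≤ q₂ := fun y hy => hq₂.2 ⟨y, hy, rfl⟩
  have h0 : (0 : ℝ) ∈ Icc (0 : ℝ) 1 := by simp
  have hRpos : 0 < R := by
    rw [← one_div_pos, hR]
    have := sub_pos.2 hlt
    positivity
  have hμ : R₁ ≤ 1 / Rμ := hR₁ ▸ min_le_left _ _
  have hk : R₁ ≤ 1 / (2 * Rk) := hR₁ ▸ (min_le_right _ _).trans (min_le_left _ _)
  have hν : R₁ ≤ R₀ / Rν := hR₁ ▸ (min_le_right _ _).trans (min_le_right _ _)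
  have hk' : R₀ / (2 * Rk) ≤ R₂ := hR₂ ▸ le_max_left _ _
  have hν' : 1 / (2 * Rν) ≤ R₂ := hR₂ ▸ le_max_right _ _
  have hr : 1 / R ≤ R₁ - R₂ := hR ▸ min_le_left _ _
  have hγ : 1 / R ≤ 1 / Rγ := hR.le.trans ((min_le_right _ _).trans (min_le_right _ _))
  constructor
  · rintro C ⟨φ, ω, h, hne⟩
    have hE := h.energy hR₀ hRk hRν hα (hU.of_le one_le_two) hW hq₁' hq₂' hμ hk hν hk' hν' hr hγ
    have := h.growth_rate_le hα hne ((abs_nonneg _).trans (hq₁' 0 h0))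
      ((abs_nonneg _).trans (hq₂' 0 h0)) (by positivity) hE
    have e : (q₁ + q₂) / (2 * α) - (Real.pi ^ 2 + α ^ 2) / (α * R) =
        ((q₁ + q₂) / 2 - (Real.pi ^ 2 + α ^ 2) * (1 / R)) / α := by
      field_simp
    rw [e, le_div_iff₀ hα, mul_comm]
    exact this
  · rintro hm hn ⟨C, ⟨φ, ω, h, hne⟩, hC⟩
    have hE := h.energy hR₀ hRk hRν hα (hU.of_le one_le_two) hW hq₁' hq₂' hμ hk hν hk' hν' hr hγ
    have hP := h.production_le_dissipation hα hm.le hn.le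
    have hpos := mul_pos (mul_pos hα hC) (h.norm_sq_integral_pos hα hne)
    -- C_i > 0 makes production strictly exceed dissipation; scaling by R turns the coefficients
    -- into αRq₁ and αRq₂, contradicting `hP`.
    have hE' := mul_lt_mul_of_pos_left (hpos.trans_le hE) hRpos
    rw [mul_zero, mul_sub, ← mul_assoc R (1 / R), mul_one_div_cancel hRpos.ne', one_mul] at hE'
    linarith
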